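/- Let $\alpha$ be a countable order type, i.e. the order type of a countable (finite or infinite) chain $C$. For a chain $C$ of type $\alpha$, let $I(\alpha)$ be the order type of the chain of all initial segments of $C$, ordered by inclusion. Let $[\omega]^{<\omega}$ be the join-semilattice of finite subsets of $\omega$, ordered by inclusion. A join-subsemilattice is a subset closed under binary joins, with the induced order, and an embedding of join-semilattices is an injective map preserving binary joins. Let $\mathcal K_\alpha$ be the class of join-subsemilattices $P$ of $[\omega]^{<\omega}$ that have a least element and for which the lattice $J(P)$ of ideals of $P$ (non-empty up-directed initial segments, ordered by inclusion) contains a chain of type $I(\alpha)$. For a poset $S$, let $I_{<\omega}(S)$ be the join-semilattice of finitely generated initial segments of $S$ (including the empty one), ordered by inclusion. A sierpinskisation of $\alpha$ and $\omega$ is a poset $S$ whose order is the intersection of two linear orders on $S$, one of type $\alpha$ and the other of type $\omega$. Then there is $Q_\alpha\in\mathcal K_\alpha$ that embeds as a join-semilattice in every member of $\mathcal K_\alpha$. Moreover, $Q_\alpha$ can be chosen isomorphic to $I_{<\omega}(S_\alpha)$, where $S_\alpha$ is a sierpinskisation of $\alpha$ and $\omega$ if $\alpha$ is infinite, and $S_\alpha$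 is a chain of type $\alpha$ if $\alpha$ is finite (so that $Q_\alpha\cong 1+\alpha$ in that case). -/

import Mathlib

/-- A join-subsemilattice of a join-semilattice `L`: a subset closed under binary joins. -/
structure JoinSubsemilattice (L : Type*) [SemilatticeSup L] where
  carrier : Set L
  sup_mem : ∀ {x y : L}, x ∈ carrier → y ∈ carrier → x ⊔ y ∈ carrier

namespace JoinSubsemilattice

instance {L : Type*} [SemilatticeSup L] : CoeSort (JoinSubsemilattice L) (Type _) :=
  ⟨fun P => {x : L // x ∈ P.carrier}⟩

/-- The induced order and join. -/
instance instSemilatticeSup {L : Type*} [SemilatticeSup L] (P : JoinSubsemilattice L) :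
    SemilatticeSup P :=
  Subtype.semilatticeSup fun _ _ hx hy => P.sup_mem hx hy

end JoinSubsemilattice

/-- `P` embeds in `Q` as a join-semilattice: there is an injective map preserving binary joins. -/
def JoinEmbeds (P Q : Type*) [SemilatticeSup P] [SemilatticeSup Q] : Prop :=
  ∃ f : SupHom P Q, Function.Injective f

/-- `P` is a join-semilattice with a least element and its lattice of ideals (non-empty
up-directed initial segments, ordered by inclusion) contains a chain of type `I(A)`, the chain of
all initial segments of the chain `A` ordered by inclusion. -/
def HasIdealChain (A : Type*) [LinearOrder A] (P : Type*) [SemilatticeSup P] : Prop :=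
  (∃ b : P, ∀ x : P, b ≤ x) ∧ Nonempty (LowerSet A ↪o Order.Ideal P)

/-- The finitely generated initial segments of a poset `S` (the empty one included). -/
def finitelyGeneratedLowerSets (S : Type*) [PartialOrder S] :
    JoinSubsemilattice (LowerSet S) where
  carrier := {I | ∃ F : Finset S, I = lowerClosure (F : Set S)}
  sup_mem := by
    classical
    rintro _ _ ⟨F, rfl⟩ ⟨G, rfl⟩
    exact ⟨F ∪ G, by rw [Finset.coe_union, lowerClosure_union]⟩

/-- The poset `S` is a sierpinskisation of the chain `A` and `ω`: its order is the intersection of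
two linear orders `r` and `s` on `S`, of type `A` and `ω` respectively. -/
def IsSierpinskisation (A : Type*) [LinearOrder A] (S : Type*) [PartialOrder S] : Prop :=
  ∃ r s : S → S → Prop,
    Nonempty (r ≃r ((· ≤ ·) : A → A → Prop)) ∧ Nonempty (s ≃r ((· ≤ ·) : ℕ → ℕ → Prop)) ∧
      ∀ x y : S, x ≤ y ↔ r x y ∧ s x y

/-! A chain of ideals of type `I(A)` in `P` yields `p a ∈ P` and distinct points `x a ∈ p a` such
that the relation "`x b ∈ p a`" lies inside `≤` and is finitary, as `p a` is finite. It thus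
suffices to find one poset `S` such that every such relation on `A`, pulled back along some `g : S →
A`, lies inside the order of `S`: then `I ↦ b ∪ ⋃ s ∈ I, p (g s)` is an embedding, since `x (g s)`
detects whether `s ∈ I`. If `A` is not well-ordered, a descending sequence can be thinned to be
independent, so any enumeration gives a suitable `S`. If `A` is an infinite well-order, the
enumeration must increase on elements at finite distance; `g` then moves elements up inside their
block of type `ω` (`exists_compatible_of_enumeration`). -/

/-- A function chosen greedily along `c`, each value avoiding what the earlier values forbid. -/
theorem exists_greedy {A B : Type*} [Nonempty B] (c : A → ℕ) (p : A → B → Prop)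
    (bad : A → B → B → Prop)
    (h : ∀ (s : A) (f : A → B), ∃ x, p s x ∧ ∀ t, c t < c s → ¬ bad s (f t) x) :
    ∃ g : A → B, ∀ s, p s (g s) ∧ ∀ t, c t < c s → ¬ bad s (g t) (g s) := by
  classical
  choose F hF hbad using h
  have wf : WellFounded (fun t s : A => c t < c s) := (measure c).wf
  let step : (s : A) → ((t : A) → c t < c s → B) → B := fun s ih =>
    F s fun t => if ht : c t < c s then ih t ht else Classical.arbitrary B
  have hg : ∀ s, wf.fix step s =
      F s fun t => if c t < c s then wf.fix step t else Classical.arbitrary B := by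
    intro s
    rw [wf.fix_eq]
    rfl
  refine ⟨wf.fix step, fun s => ⟨?_, fun t ht => ?_⟩⟩
  · rw [hg]
    exact hF _ _
  · have := hbad s (fun t => if c t < c s then wf.fix step t else Classical.arbitrary B) t ht
    rw [if_pos ht, ← hg] at this
    exact this

/-- In a chain that is not well-ordered, every finitary relation contained in the order has an
infinite independent sequence. -/
theorem exists_independent_of_not_wellFoundedLT {A : Type*} [LinearOrder A]
    (hA : ¬ WellFoundedLT A) (R : A → A → Prop) (hfin : ∀ a, {b | R b a}.Finite)
    (hle : ∀ b a, R b a → b ≤ a) :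
    ∃ g : ℕ → A, ∀ n m, R (g n) (g m) → n = m := by
  obtain ⟨a, ha⟩ : ∃ a : ℕ → A, StrictAnti a := by
    have hA' : ¬ WellFounded ((· < ·) : A → A → Prop) := fun h => hA ⟨h⟩
    rw [wellFounded_iff_isEmpty_descending_chain, not_isEmpty_iff] at hA'
    obtain ⟨a, ha⟩ := hA'
    exact ⟨a, strictAnti_nat_of_succ_lt ha⟩
  obtain ⟨k, hk⟩ := exists_greedy (id : ℕ → ℕ) (fun _ (_ : ℕ) => True)
    -- The first clause makes `k` increasing, so `hle` rules out relations from earlier to later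
    -- terms; the second rules out the others.
    (fun _ m i => i ≤ m ∨ R (a i) (a m)) (by
      intro n f
      have hbad : (⋃ t ∈ {t | t < n}, ({i | i ≤ f t} ∪ {i | R (a i) (a (f t))})).Finite :=
        (Set.finite_lt_nat n).biUnion fun t _ =>
          (Set.finite_le_nat _).union ((hfin _).preimage ha.injective.injOn)
      obtain ⟨i, hi⟩ := hbad.infinite_compl.nonempty
      exact ⟨i, trivial, fun t ht h => hi (Set.mem_biUnion (x := t) ht h)⟩)
  refine ⟨a ∘ k, fun n m h => ?_⟩
  rcases lt_trichotomy n m with hlt | heq | hlt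
  · have h1 : k n < k m := not_le.1 fun h' => (hk m).2 n hlt (Or.inl h')
    exact absurd (hle _ _ h) (not_le.2 (ha h1))
  · exact heq
  · exact absurd (Or.inr h) ((hk n).2 m hlt)

/-! ### Well-ordered chains -/

section WellOrder

variable {A : Type*} [LinearOrder A] [WellFoundedLT A]

/-- Every element `a` of a well-order has a least element `m a` at finite distance below it. -/
theorem exists_root (A : Type*) [LinearOrder A] [WellFoundedLT A] :
    ∃ m : A → A, ∀ a, m a ≤ a ∧ (Set.Icc (m a) a).Finite ∧
      ∀ b ≤ a, (Set.Icc b a).Finite → m a ≤ b := by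
  have h : ∀ a : A, ∃ m, m ≤ a ∧ (Set.Icc m a).Finite ∧
      ∀ b ≤ a, (Set.Icc b a).Finite → m ≤ b := by
    intro a
    obtain ⟨m, ⟨h1, h2⟩, h3⟩ := (wellFounded_lt (α := A)).has_min
      {b | b ≤ a ∧ (Set.Icc b a).Finite} ⟨a, le_rfl, by simp⟩
    exact ⟨m, h1, h2, fun b hb hb' => not_lt.1 (h3 b ⟨hb, hb'⟩)⟩
  exact ⟨fun a => (h a).choose, fun a => (h a).choose_spec⟩

/-- Otherwise the least element beyond this finite set would itself be at finite distance from `a`.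
This gives the greedy choice its room. -/
theorem infinite_setOf_finite_Icc {a : A} (ha : ¬ (Set.Ici a).Finite) :
    {b | a ≤ b ∧ (Set.Icc a b).Finite}.Infinite := by
  intro hW
  obtain ⟨d, ⟨had, hd⟩, hmin⟩ := (wellFounded_lt (α := A)).has_min
    (Set.Ici a \ {b | a ≤ b ∧ (Set.Icc a b).Finite}) (Set.Infinite.sdiff ha hW).nonempty
  refine hd ⟨had, (hW.union (Set.finite_singleton d)).subset fun b hb => ?_⟩
  rcases hb.2.eq_or_lt with h | h
  · exact Or.inr h
  · left
    by_contra hb'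
    exact hmin b ⟨hb.1, hb'⟩ h

/-- A countable well-order has an injection into `ℕ` that is increasing on elements at finite
distance. -/
theorem exists_enumeration [Countable A] :
    ∃ c : A → ℕ, Function.Injective c ∧ ∀ s t, s < t → (Set.Icc s t).Finite → c s < c t := by
  classical
  obtain ⟨e, he⟩ := exists_injective_nat A
  obtain ⟨m, hm⟩ := exists_root A
  let d : A → ℕ := fun a => (Set.Icc (m a) a).ncard
  have hmd : ∀ s t, s < t → (Set.Icc s t).Finite → m s = m t ∧ d s < d t := by
    intro s t hst hfin
    have h1 : m t ≤ s := (hm t).2.2 s hst.le hfin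
    have h2 : m s = m t := by
      refine le_antisymm ((hm s).2.2 _ h1 ((hm t).2.1.subset
        (Set.Icc_subset_Icc_right hst.le))) ((hm t).2.2 _ ((hm s).1.trans hst.le) ?_)
      refine ((hm s).2.1.union hfin).subset fun b hb => ?_
      rcases le_total b s with h | h
      · exact Or.inl ⟨hb.1, h⟩
      · exact Or.inr ⟨h, hb.2⟩
    refine ⟨h2, Set.ncard_lt_ncard ?_ (hm t).2.1⟩
    rw [h2]
    refine ⟨Set.Icc_subset_Icc_right hst.le, fun h => ?_⟩
    exact absurd (h ⟨(hm t).1, le_rfl⟩).2 (not_le.2 hst)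
  have hmono : ∀ s t, s < t → (Set.Icc s t).Finite →
      -- The first coordinate names the block, the second is the position in it.
      Nat.pair (e (m s)) (d s) < Nat.pair (e (m t)) (d t) := by
    intro s t hst hfin
    obtain ⟨h1, h2⟩ := hmd s t hst hfin
    rw [h1]
    exact Nat.pair_lt_pair_right _ h2
  refine ⟨fun a => Nat.pair (e (m a)) (d a), ?_, hmono⟩
  have key : ∀ s t, s < t → Nat.pair (e (m s)) (d s) ≠ Nat.pair (e (m t)) (d t) := by
    intro s t hst hc
    refine (hmono s t hst ?_).ne hc
    have h1 : m s = m t := he (Nat.pair_eq_pair.1 hc).1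
    exact (hm t).2.1.subset (Set.Icc_subset_Icc_left (h1 ▸ (hm s).1))
  intro s t hc
  rcases lt_trichotomy s t with h | h | h
  · exact absurd hc (key s t h)
  · exact h
  · exact absurd hc.symm (key t s h)

/-- With an enumeration as in `exists_enumeration`, every finitary relation contained in the order
becomes compatible with the enumeration after a strictly increasing self-map. -/
theorem exists_compatible_of_enumeration {c : A → ℕ} (hc : Function.Injective c)
    (hmono : ∀ s t, s < t → (Set.Icc s t).Finite → c s < c t)
    (R : A → A → Prop) (hfin : ∀ a, {b | R b a}.Finite) (hle : ∀ b a, R b a → b ≤ a) :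
    ∃ g : A → A, ∀ s t, R (g s) (g t) → s ≤ t ∧ c s ≤ c t := by
  classical
  rcases isEmpty_or_nonempty A with _ | _
  · exact ⟨id, fun s => isEmptyElim s⟩
  obtain ⟨g, hg⟩ := exists_greedy c
    -- `g s` stays in the block of `s`; a finite last block leaves no room to move, so `g` fixes it.
    (fun s b => s ≤ b ∧ (Set.Icc s b).Finite ∧ ((Set.Ici s).Finite → b = s))
    -- Avoiding `Set.Icc s x` forces `b > x` within a block, which makes `g` strictly monotone.
    (fun s x b => ¬ (Set.Ici s).Finite ∧ (R b x ∨ (Set.Icc s x).Finite ∧ b ∈ Set.Icc s x)) (by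
      intro s f
      by_cases hs : (Set.Ici s).Finite
      · exact ⟨s, ⟨le_rfl, by simp, fun _ => rfl⟩, fun t _ h => h.1 hs⟩
      · have hbad : (⋃ t ∈ {t | c t < c s}, ({b | R b (f t)} ∪
            {b | (Set.Icc s (f t)).Finite ∧ b ∈ Set.Icc s (f t)})).Finite := by
          refine Set.Finite.biUnion ((Set.finite_lt_nat (c s)).preimage hc.injOn) fun t _ => ?_
          refine (hfin _).union ?_
          by_cases h : (Set.Icc s (f t)).Finite
          · exact h.subset fun b hb => hb.2
          · exact Set.finite_empty.subset fun b hb => h hb.1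
        obtain ⟨b, hb, hb'⟩ := ((infinite_setOf_finite_Icc hs).sdiff hbad).nonempty
        refine ⟨b, ⟨hb.1, hb.2, fun h => absurd h hs⟩, fun t ht h => hb' ?_⟩
        exact Set.mem_biUnion (x := t) ht h.2)
  have hg_mono : StrictMono g := by
    intro s t hst
    by_cases hf : (Set.Icc s t).Finite
    · by_cases ht : (Set.Ici t).Finite
      · have hs : (Set.Ici s).Finite := by
          refine (hf.union ht).subset fun b hb => ?_
          rcases le_total b t with h | h
          · exact Or.inl ⟨hb, h⟩
          · exact Or.inr h
        rwa [(hg s).1.2.2 hs, (hg t).1.2.2 ht]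
      · by_contra hlt
        refine (hg t).2 s (hmono s t hst hf) ⟨ht, Or.inr ⟨?_, (hg t).1.1, not_lt.1 hlt⟩⟩
        exact (hg s).1.2.1.subset (Set.Icc_subset_Icc_left hst.le)
    · refine lt_of_lt_of_le ?_ (hg t).1.1
      by_contra hlt
      exact hf ((hg s).1.2.1.subset (Set.Icc_subset_Icc_right (not_lt.1 hlt)))
  refine ⟨g, fun s t hR => ?_⟩
  have hst : s ≤ t := hg_mono.le_iff_le.1 (hle _ _ hR)
  refine ⟨hst, ?_⟩
  by_contra hlt
  rw [not_le] at hlt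
  by_cases hs : (Set.Ici s).Finite
  · refine hlt.not_ge ?_
    rcases hst.eq_or_lt with h | h
    · rw [h]
    · exact (hmono s t h (hs.subset fun b hb => hb.1)).le
  · exact (hg s).2 t hlt ⟨hs, Or.inl hR⟩

end WellOrder

/-- A countably infinite chain has an enumeration `e` such that every finitary relation contained in
the order can be pulled back into the intersection of the order and the enumeration. -/
theorem exists_equiv_nat_compatible (A : Type*) [LinearOrder A] [Countable A] [Infinite A] :
    ∃ e : ℕ ≃ A, ∀ R : A → A → Prop, (∀ a, {b | R b a}.Finite) → (∀ b a, R b a → b ≤ a) →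
      ∃ g : ℕ → A, ∀ n m, R (g n) (g m) → n ≤ m ∧ e n ≤ e m := by
  classical
  by_cases hA : WellFoundedLT A
  · obtain ⟨c, hc, hmono⟩ := exists_enumeration (A := A)
    have : Infinite (Set.range c) := (Set.infinite_range_of_injective hc).to_subtype
    let o : ℕ ≃o Set.range c := Nat.Subtype.orderIsoOfNat (Set.range c)
    let e : ℕ ≃ A := o.toEquiv.trans (Equiv.ofInjective c hc).symm
    have he : ∀ n, c (e n) = o n := fun n => Equiv.apply_ofInjective_symm hc (o n)
    refine ⟨e, fun R hfin hle => ?_⟩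
    obtain ⟨g, hg⟩ := exists_compatible_of_enumeration hc hmono R hfin hle
    refine ⟨fun n => g (e n), fun n m h => ?_⟩
    obtain ⟨h1, h2⟩ := hg _ _ h
    rw [he, he] at h2
    exact ⟨o.le_iff_le.1 h2, h1⟩
  · obtain ⟨e⟩ : Nonempty (ℕ ≃ A) := by
      obtain ⟨_⟩ := nonempty_denumerable A
      exact ⟨(Denumerable.eqv A).symm⟩
    refine ⟨e, fun R hfin hle => ?_⟩
    obtain ⟨g, hg⟩ := exists_independent_of_not_wellFoundedLT hA R hfin hle
    refine ⟨g, fun n m h => ?_⟩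
    rw [hg n m h]
    exact ⟨le_rfl, le_rfl⟩

/-- The natural numbers, ordered by the intersection of their order and the order of `A` pulled back
along `e`. -/
def EnumeratedPoset {A : Type*} (_ : ℕ ≃ A) : Type := ℕ

instance EnumeratedPoset.instPartialOrder {A : Type*} [LinearOrder A] (e : ℕ ≃ A) :
    PartialOrder (EnumeratedPoset e) where
  le n m := e n ≤ e m ∧ Nat.le n m
  le_refl n := ⟨le_rfl, Nat.le_refl n⟩
  le_trans _ _ _ h h' := ⟨h.1.trans h'.1, Nat.le_trans h.2 h'.2⟩
  le_antisymm _ _ h h' := Nat.le_antisymm h.2 h'.2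

/-- Each countable chain `A` has a universal poset `S`: a sierpinskisation of `A` and `ω`, or `A`
itself if `A` is finite. -/
theorem exists_universal_poset (A : Type*) [LinearOrder A] [Countable A] :
    ∃ (S : Type) (_ : PartialOrder S),
      (Infinite A → IsSierpinskisation A S) ∧ (Finite A → Nonempty (S ≃o A)) ∧
      ∃ (ι : S → ℕ) (e : S → A), Function.Injective ι ∧ Monotone e ∧ Function.Surjective e ∧
        (∀ s : S, (Set.Iic s).Finite) ∧
        ∀ R : A → A → Prop, (∀ a, {b | R b a}.Finite) → (∀ b a, R b a → b ≤ a) →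
          ∃ g : S → A, ∀ s t, R (g s) (g t) → s ≤ t := by
  rcases finite_or_infinite A with hA | hA
  · have := Fintype.ofFinite A
    let o : Fin (Fintype.card A) ≃o A := (Fintype.orderIsoFinOfCardEq A rfl)
    exact ⟨Fin (Fintype.card A), inferInstance, fun h => absurd hA h.not_finite, fun _ => ⟨o⟩,
      fun i => i, o, Fin.val_injective, o.monotone, o.surjective, fun s => Set.toFinite _,
      fun R _ hle => ⟨o, fun s t h => o.le_iff_le.1 (hle _ _ h)⟩⟩
  · obtain ⟨e, he⟩ := exists_equiv_nat_compatible A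
    refine ⟨EnumeratedPoset e, inferInstance, fun _ => ?_, fun h => absurd h hA.not_finite,
      fun n => n, e, fun _ _ h => h, fun _ _ h => h.1, e.surjective,
      fun n => (Set.finite_le_nat n).subset fun m hm => hm.2, fun R hfin hle => ?_⟩
    · exact ⟨fun n m => e n ≤ e m, fun n m => Nat.le n m, ⟨⟨e, Iff.rfl⟩⟩,
        ⟨⟨Equiv.refl ℕ, Iff.rfl⟩⟩, fun _ _ => Iff.rfl⟩
    · obtain ⟨g, hg⟩ := he R hfin hle
      exact ⟨g, fun s t h => ⟨(hg s t h).2, (hg s t h).1⟩⟩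

/-! ### From ideal chains to join embeddings -/

/-- A chain of ideals of type `I(A)` yields elements `p a` of `P` and points `x a ∈ p a` such that
`x b ∈ p a` only if `b ≤ a`. -/
theorem HasIdealChain.exists_points {A : Type*} [LinearOrder A] {P : JoinSubsemilattice (Finset ℕ)}
    (h : HasIdealChain A P) :
    ∃ b : P, ∃ p : A → P, ∃ x : A → ℕ, (∀ a, x a ∉ b.1) ∧ (∀ a, x a ∈ (p a).1) ∧
      ∀ a a', x a' ∈ (p a).1 → a' ≤ a := by
  obtain ⟨⟨b, hb⟩, ⟨Φ⟩⟩ := h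
  have hdir : ∀ (I : Order.Ideal P) (F : Finset ℕ), (∀ n ∈ F, ∃ q ∈ I, n ∈ q.1) →
      ∃ q ∈ I, F ⊆ q.1 := by
    intro I F
    induction F using Finset.induction_on with
    | empty =>
      intro _
      obtain ⟨q, hq⟩ := I.nonempty
      exact ⟨q, hq, Finset.empty_subset _⟩
    | insert n F _ ih =>
      intro hF
      obtain ⟨q, hq, hFq⟩ := ih fun k hk => hF k (Finset.mem_insert_of_mem hk)
      obtain ⟨r, hr, hnr⟩ := hF n (Finset.mem_insert_self _ _)
      refine ⟨r ⊔ q, Order.Ideal.sup_mem hr hq, fun k hk => ?_⟩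
      rcases Finset.mem_insert.1 hk with rfl | hk
      · exact (le_sup_left : r ≤ r ⊔ q) hnr
      · exact (le_sup_right : q ≤ r ⊔ q) (hFq hk)
  have hpt : ∀ a : A, ∃ p : P, ∃ x : ℕ, p ∈ Φ (LowerSet.Iic a) ∧ x ∈ p.1 ∧
      ∀ q ∈ Φ (LowerSet.Iio a), x ∉ q.1 := by
    intro a
    have hlt : ¬ Φ (LowerSet.Iic a) ≤ Φ (LowerSet.Iio a) := by
      rw [Φ.le_iff_le]
      exact fun h => lt_irrefl a (LowerSet.mem_Iio_iff.1 (h (LowerSet.mem_Iic_iff.2 le_rfl)))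
    -- If the smaller ideal covered `p` pointwise, directedness would give one member containing the
    -- finite set `p`.
    obtain ⟨p, hp, hp'⟩ := Set.not_subset.1 hlt
    by_contra hcon
    push Not at hcon
    obtain ⟨q, hq, hpq⟩ := hdir (Φ (LowerSet.Iio a)) p.1 fun n hn => hcon p n hp hn
    exact hp' ((Φ (LowerSet.Iio a)).lower (show p ≤ q from hpq) hq)
  choose p x hp hx hx' using hpt
  refine ⟨b, p, x, fun a => ?_, hx, fun a a' ha => ?_⟩
  · obtain ⟨q, hq⟩ := (Φ (LowerSet.Iio a)).nonempty
    exact hx' a b ((Φ (LowerSet.Iio a)).lower (hb q) hq)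
  · by_contra hlt
    refine hx' a' (p a) (Φ.le_iff_le.2 (fun c hc => ?_) (hp a)) ha
    exact LowerSet.mem_Iio_iff.2 ((LowerSet.mem_Iic_iff.1 hc).trans_lt (not_le.1 hlt))

theorem finite_of_mem_finitelyGeneratedLowerSets {S : Type*} [PartialOrder S]
    (hS : ∀ s : S, (Set.Iic s).Finite) {I : LowerSet S}
    (hI : I ∈ (finitelyGeneratedLowerSets S).carrier) : (I : Set S).Finite := by
  obtain ⟨F, rfl⟩ := hI
  refine (F.finite_toSet.biUnion fun s _ => hS s).subset fun t ht => ?_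
  obtain ⟨s, hs, hts⟩ := ht
  exact Set.mem_biUnion hs hts

theorem Iic_mem_finitelyGeneratedLowerSets {S : Type*} [PartialOrder S] (s : S) :
    LowerSet.Iic s ∈ (finitelyGeneratedLowerSets S).carrier :=
  ⟨{s}, by simp⟩

/-- The base `b` serves as the image of the empty segment, and contains no `x s` that could spoil
injectivity. -/
theorem joinEmbeds_of_points {S : Type*} [PartialOrder S] (hS : ∀ s : S, (Set.Iic s).Finite)
    {P : JoinSubsemilattice (Finset ℕ)} (b : P) (p : S → P) (x : S → ℕ) (hb : ∀ s, x s ∉ b.1)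
    (hx : ∀ s, x s ∈ (p s).1) (hle : ∀ s t, x s ∈ (p t).1 → s ≤ t) :
    JoinEmbeds (finitelyGeneratedLowerSets S) P := by
  classical
  have hex : ∀ F : Finset S, ∃ q : P, ∀ n, n ∈ q.1 ↔ n ∈ b.1 ∨ ∃ s ∈ F, n ∈ (p s).1 := by
    intro F
    induction F using Finset.induction_on with
    | empty => exact ⟨b, by simp⟩
    | insert s F _ ih =>
      obtain ⟨q, hq⟩ := ih
      refine ⟨p s ⊔ q, fun n => ?_⟩
      have : n ∈ (p s ⊔ q).1 ↔ n ∈ (p s).1 ∨ n ∈ q.1 := Finset.mem_union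
      rw [this, hq]
      simp only [Finset.exists_mem_insert]
      tauto
  have hex' : ∀ I : finitelyGeneratedLowerSets S, ∃ q : P,
      ∀ n, n ∈ q.1 ↔ n ∈ b.1 ∨ ∃ s ∈ I.1, n ∈ (p s).1 := by
    intro I
    obtain ⟨q, hq⟩ := hex (finite_of_mem_finitelyGeneratedLowerSets hS I.2).toFinset
    exact ⟨q, by simpa using hq⟩
  choose f hf using hex'
  refine ⟨⟨f, fun I J => ?_⟩, fun I J h => ?_⟩
  · apply Subtype.ext
    ext n
    have h1 : n ∈ (f I ⊔ f J).1 ↔ n ∈ (f I).1 ∨ n ∈ (f J).1 := Finset.mem_union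
    have h2 : ∀ s, s ∈ (I ⊔ J).1 ↔ s ∈ I.1 ∨ s ∈ J.1 := fun s => LowerSet.mem_sup_iff
    rw [h1, hf, hf, hf]
    simp only [h2, or_and_right, exists_or]
    exact or_or_distrib_left
  · have hmem : ∀ (K : finitelyGeneratedLowerSets S) s, x s ∈ (f K).1 ↔ s ∈ K.1 := by
      intro K s
      rw [hf]
      refine ⟨fun h => ?_, fun h => Or.inr ⟨s, h, hx s⟩⟩
      rcases h with h | ⟨t, ht, h⟩
      · exact absurd h (hb s)
      · exact K.1.lower (hle s t h) ht
    have h' : f I = f J := h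
    apply Subtype.ext
    ext s
    rw [SetLike.mem_coe, SetLike.mem_coe, ← hmem, ← hmem, h']

/-- An initial segment `I` of `A` gives the ideal of those `K` with `e '' K ⊆ I`; principal segments
recover `I`, as `e` is monotone and onto. -/
theorem hasIdealChain_finitelyGeneratedLowerSets {A S : Type*} [LinearOrder A] [PartialOrder S]
    {e : S → A} (he : Monotone e) (hsurj : Function.Surjective e) :
    HasIdealChain A (finitelyGeneratedLowerSets S) := by
  refine ⟨⟨⟨⊥, ∅, by simp⟩, fun I => (bot_le : ⊥ ≤ I.1)⟩, ⟨OrderEmbedding.ofMapLEIff (fun I =>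
    { carrier := {K | ∀ s ∈ K.1, e s ∈ I}
      lower' := fun K L h hK s hs => hK s (h hs)
      nonempty' := ⟨⟨⊥, ∅, by simp⟩, fun s hs => absurd hs (LowerSet.notMem_bot)⟩
      directed' := fun K hK L hL => ⟨K ⊔ L, fun s hs => ?_, le_sup_left, le_sup_right⟩ }) ?_⟩⟩
  · rcases LowerSet.mem_sup_iff.1 (show s ∈ K.1 ⊔ L.1 from hs) with h | h
    · exact hK s h
    · exact hL s h
  · intro I J
    refine ⟨fun h a ha => ?_, fun h K hK s hs => h (hK s hs)⟩
    obtain ⟨s, rfl⟩ := hsurj a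
    exact h (x := ⟨_, Iic_mem_finitelyGeneratedLowerSets s⟩)
      (fun t ht => I.lower (he ht) ha) s (LowerSet.mem_Iic_iff.2 le_rfl)

theorem HasIdealChain.of_orderIso {A P Q : Type*} [LinearOrder A] [SemilatticeSup P]
    [SemilatticeSup Q] (o : P ≃o Q) (h : HasIdealChain A P) : HasIdealChain A Q := by
  obtain ⟨⟨b, hb⟩, ⟨Φ⟩⟩ := h
  refine ⟨⟨o b, fun x => o.le_symm_apply.1 (hb _)⟩, ⟨Φ.trans (OrderEmbedding.ofMapLEIff (fun I =>
    { carrier := o.symm ⁻¹' I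
      lower' := fun x y h hx => I.lower (o.symm.monotone h) hx
      nonempty' := I.nonempty.elim fun x hx => ⟨o x, by simpa using hx⟩
      directed' := fun x hx y hy => ⟨x ⊔ y, ?_, le_sup_left, le_sup_right⟩ }) ?_)⟩⟩
  · rw [Set.mem_preimage, map_sup]
    exact Order.Ideal.sup_mem hx hy
  · intro I J
    refine ⟨fun h x hx => ?_, fun h x hx => h hx⟩
    have hx' : o.symm (o x) ∈ J := h (x := o x) (show o.symm (o x) ∈ I by simpa using hx)
    simpa using hx'

theorem JoinEmbeds.of_orderIso {P Q R : Type*} [SemilatticeSup P] [SemilatticeSup Q]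
    [SemilatticeSup R] (o : P ≃o Q) (h : JoinEmbeds Q R) : JoinEmbeds P R := by
  obtain ⟨f, hf⟩ := h
  exact ⟨⟨fun x => f (o x), fun x y => by rw [map_sup, map_sup]⟩, hf.comp o.injective⟩

/-- If `S` is countable with finite principal initial segments, then its finitely generated initial
segments form a join-subsemilattice of the finite subsets of `ω`. -/
theorem exists_joinSubsemilattice_orderIso {S : Type*} [PartialOrder S]
    (hS : ∀ s : S, (Set.Iic s).Finite) {ι : S → ℕ} (hι : Function.Injective ι) :
    ∃ Q : JoinSubsemilattice (Finset ℕ), Nonempty (Q ≃o finitelyGeneratedLowerSets S) := by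
  classical
  let F : finitelyGeneratedLowerSets S → Finset ℕ := fun I =>
    (finite_of_mem_finitelyGeneratedLowerSets hS I.2).toFinset.image ι
  have hF : ∀ I n, n ∈ F I ↔ ∃ s ∈ I.1, ι s = n := by simp [F]
  have hle : ∀ I J, F I ≤ F J ↔ I ≤ J := by
    intro I J
    refine ⟨fun h s hs => ?_, fun h n hn => ?_⟩
    · obtain ⟨t, ht, hts⟩ := (hF J _).1 (h ((hF I _).2 ⟨s, hs, rfl⟩))
      rwa [hι hts] at ht
    · obtain ⟨s, hs, hsn⟩ := (hF I _).1 hn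
      exact (hF J _).2 ⟨s, h hs, hsn⟩
  have hsup : ∀ I J, F (I ⊔ J) = F I ⊔ F J := by
    intro I J
    ext n
    have h2 : ∀ s, s ∈ (I ⊔ J).1 ↔ s ∈ I.1 ∨ s ∈ J.1 := fun s => LowerSet.mem_sup_iff
    rw [Finset.sup_eq_union, Finset.mem_union, hF, hF, hF]
    simp only [h2, or_and_right, exists_or]
  let o : finitelyGeneratedLowerSets S ↪o Finset ℕ := OrderEmbedding.ofMapLEIff F hle
  refine ⟨⟨Set.range o, ?_⟩, ⟨o.orderIso.symm⟩⟩
  rintro _ _ ⟨I, rfl⟩ ⟨J, rfl⟩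
  exact ⟨I ⊔ J, hsup I J⟩

theorem mainTheorem3 {A : Type*} [LinearOrder A] [Countable A] :
    ∃ (S : Type) (_ : PartialOrder S),
      (Infinite A → IsSierpinskisation A S) ∧ (Finite A → Nonempty (S ≃o A)) ∧
      ∃ Q : JoinSubsemilattice (Finset ℕ),
        HasIdealChain A Q ∧ Nonempty (Q ≃o finitelyGeneratedLowerSets S) ∧
        ∀ P : JoinSubsemilattice (Finset ℕ), HasIdealChain A P → JoinEmbeds Q P := by
  obtain ⟨S, _, hinf, hfin, ι, e, hι, he, hsurj, hS, huniv⟩ := exists_universal_poset A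
  obtain ⟨Q, ⟨o⟩⟩ := exists_joinSubsemilattice_orderIso hS hι
  refine ⟨S, inferInstance, hinf, hfin, Q,
    (hasIdealChain_finitelyGeneratedLowerSets he hsurj).of_orderIso o.symm, ⟨o⟩, fun P hP => ?_⟩
  obtain ⟨b, p, x, hb, hx, hle⟩ := hP.exists_points
  have hxinj : Function.Injective x := fun a a' h =>
    le_antisymm (hle _ _ (h ▸ hx a')) (hle _ _ (h ▸ hx a))
  obtain ⟨g, hg⟩ := huniv (fun a' a => x a' ∈ (p a).1)
    (fun a => (p a).1.finite_toSet.preimage hxinj.injOn) (fun a' a h => hle a a' h)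
  exact (joinEmbeds_of_points hS b (p ∘ g) (x ∘ g) (fun s => hb _) (fun s => hx _) hg).of_orderIso o
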